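/- Let $d\ge 2$, $T>0$, $[d]=\{1,\dots,d\}$. Let $e_1,\dots,e_d$ be the standard basis of $\mathbb R^d$, $e_{yz}=e_z-e_y$, let $\|\cdot\|$ be the Euclidean norm, $\mathcal P([d])=\{\eta\in\mathbb R_+^d:\sum_x\eta_x=1\}$, $\mathcal P^{m}([d])=\{\eta\in\mathcal P([d]): m\eta\in(\mathbb N\cup\{0\})^d\}$, $\mathbb R^d_x=\{a\in\mathbb R^d: a_y\ge 0\ (y\neq x),\ a_x=-\sum_{y\ne x}a_y\}$, and $\Delta_x\phi=(\phi(l)-\phi(x))_{l\in[d]}$ for $\phi:[d]\to\mathbb R$. Let $f(x,\eta,a)$ be a real running cost and $g(x,\eta)$ a real terminal cost. Put $$H(x,\eta,p)=\inf_{a\in\mathbb R^d_x}h(x,\eta,a,p),\qquad h(x,\eta,a,p)=f(x,\eta,a)+\sum_{y\ne x}a_yp_y .$$ Assume that for all $(x,\eta,p)\in[d]\times\mathcal P([d])\times\mathbb R^d$ the function $h(x,\eta,\cdot,p)$ has a unique minimizer $a^*(x,\eta,p)$ in $\mathbb R^d_x$, and that $a^*$ is measurable. For $n\ge2$ let $D^{n,y,z}\phi(\eta)=(n-1)\big(\phi(\eta+\tfrac1{n-1}e_{yz})-\phi(\eta)\big)$.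 Assume that the following two systems have unique classical solutions $V^n:[0,T]\times[d]\times\mathcal P^{n-1}([d])\to\mathbb R$ (for every $n\ge 2$) and $U:[0,T]\times[d]\times\mathcal P([d])\to\mathbb R$: the HJB system $$-\partial_tV^n(t,x,\eta)=\sum_{y,z}\eta_yD^{n,y,z}V^n(t,x,\eta)\,a^*_z\big(y,\eta+\tfrac{1}{n-1}e_{yx},\Delta_yV^n(t,\cdot,\eta+\tfrac1{n-1}e_{yx})\big)+H(x,\eta,\Delta_xV^n(t,\cdot,\eta)),$$ with $V^n(T,x,\eta)=g(x,\eta)$ (summands with $\eta_y=0$ are $0$), and the master equation $$-\partial_tU(t,x,\eta)=\sum_{y,z}\partial_{\eta_z}U(t,x,\eta)\,\eta_y\,a^*_z(y,\eta,\Delta_yU(t,\cdot,\eta))+H(x,\eta,\Delta_xU(t,\cdot,\eta)),$$ with $U(T,x,\eta)=g(x,\eta)$. A classical solution of the first system is differentiable in $t$ and satisfies the system on $[0,T]$ (with one-sided derivatives at the end points). A classical solution of the second is continuous, differentiable in $t$ and in $\eta$ (along the simplex, with tangential gradient $\nabla_\eta U=(\partial_{\eta_z}U)_z$), and satisfies the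 equation everywhere. Assume moreover that $\nabla_\eta U$ is bounded and is Lipschitz in $\eta$, uniformly in $(t,x)$. Let $R$ be such that $|U(t,y,\eta)-U(t,x,\eta)|<R$ for all $t,x,y,\eta$ (for instance any $R>2\sup|U|$; also $R=2\sup|U|$, unless some increment of $U$ attains this value), and assume that on $[d]\times\mathcal P([d])\times[-R,R]^d$: * $a^*(x,\cdot,\cdot)$ is Lipschitz; * $a^*_y(x,\cdot,\cdot)$ is bounded below by a positive constant for all $x\ne y$; * $H(x,\eta,\cdot)$ is Lipschitz in $p$, uniformly in $(x,\eta)$. Set $W^n=V^n-U$. Then there is a constant $C>0$ such that for every $t_0\in[0,T]$ and every $n\ge2$ the following two statements hold. (i) Let $X^n=(X^{n,1},\dots,X^{n,n})$ be the $[d]^n$-valued jump process on $[t_0,T]$ in which, at time $t$, each player $i$ moves from its state to a state $z\neq X^{n,i}(t-)$ at rate $a^*_z\big(X^{n,i}(t-),\mu^{n,i}(t-),\Delta_{X^{n,i}(t-)}V^n(t,\cdot,\mu^{n,i}(t-))\big)$, where $\mu^{n,i}(t)=\frac1{n-1}\sum_{j\ne i}e_{X^{n,j}(t)}$ (no two players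 jump simultaneously), started from i.i.d. random variables $X^{n,1}(t_0),\dots,X^{n,n}(t_0)$. Then for every $i\in\{1,\dots,n\}$, $$\mathbb E\big[W^n(t_0,X^{n,i}(t_0),\mu^{n,i}(t_0))^2\big]+\int_{t_0}^T\mathbb E\Big[\big\|\Delta_{X^{n,i}(s-)}W^n(s,\cdot,\mu^{n,i}(s-))\big\|^2\Big]ds\le\frac{C}{n^2}.$$ (ii) For every ${\bf x}=(x_1,\dots,x_n)\in[d]^n$, with $m^{n,i}_{\bf x}=\frac1{n-1}\sum_{j\neq i}e_{x_j}$, $$\frac1n\sum_{i=1}^n\big|V^n(t_0,x_i,m^{n,i}_{\bf x})-U(t_0,x_i,m^{n,i}_{\bf x})\big|\le\frac Cn .$$ -/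

import Mathlib

open MeasureTheory ProbabilityTheory Set Filter Topology

noncomputable section

namespace FiniteStateGame

/-- `ℝ^d` with the Euclidean norm. -/
abbrev Vec (d : ℕ) : Type := EuclideanSpace ℝ (Fin d)

/-- The set `𝒫([d])` of probability vectors. -/
def simplex (d : ℕ) : Set (Vec d) := {η | (∀ i, 0 ≤ η i) ∧ ∑ i, η i = 1}

/-- The probability vectors all of whose entries are integer multiples of `1/m`, that is, the
empirical measures of `m` particles. -/
def grid (d m : ℕ) : Set (Vec d) := {η | η ∈ simplex d ∧ ∀ i, ∃ k : ℕ, (m : ℝ) * η i = k}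

/-- The standard basis vector `e_x`. -/
def basisVec {d : ℕ} (x : Fin d) : Vec d := EuclideanSpace.single x (1 : ℝ)

/-- `e_{yz} = e_z - e_y`. -/
def dir {d : ℕ} (y z : Fin d) : Vec d := basisVec z - basisVec y

/-- The vectors of transition rates out of the state `x` (the set `ℝ^d_x`). -/
def rateSet {d : ℕ} (x : Fin d) : Set (Vec d) :=
  {a | (∀ y, y ≠ x → 0 ≤ a y) ∧ a x = -∑ z ∈ Finset.univ.erase x, a z}

/-- `Δ_x φ = (φ(l) - φ(x))_l`. -/
def delta {d : ℕ} (x : Fin d) (φ : Fin d → ℝ) : Vec d := WithLp.toLp 2 fun l => φ l - φ x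

/-- The pre-Hamiltonian `h(x, η, a, p) = f(x, η, a) + ∑_{y ≠ x} a_y p_y`. -/
def preHam {d : ℕ} (f : Fin d → Vec d → Vec d → ℝ) (x : Fin d) (η a p : Vec d) : ℝ :=
  f x η a + ∑ y ∈ Finset.univ.erase x, a y * p y

/-- The Hamiltonian `H(x, η, p) = inf_{a ∈ ℝ^d_x} h(x, η, a, p)`. -/
def ham {d : ℕ} (f : Fin d → Vec d → Vec d → ℝ) (x : Fin d) (η p : Vec d) : ℝ :=
  sInf ((fun a => preHam f x η a p) '' rateSet x)

/-- `astar` is measurable and `astar x η p` is the unique minimizer of `h(x, η, ·, p)` over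
`ℝ^d_x`, for all states `x`, all `η ∈ 𝒫([d])` and all `p ∈ ℝ^d`. -/
structure IsUniqueMinimizer {d : ℕ} (f : Fin d → Vec d → Vec d → ℝ)
    (astar : Fin d → Vec d → Vec d → Vec d) : Prop where
  measurable : ∀ x, Measurable fun q : simplex d × Vec d => astar x (q.1 : Vec d) q.2
  mem : ∀ x, ∀ η ∈ simplex d, ∀ p, astar x η p ∈ rateSet x
  lt : ∀ x, ∀ η ∈ simplex d, ∀ p, ∀ a ∈ rateSet x, a ≠ astar x η p →
    preHam f x η (astar x η p) p < preHam f x η a p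

/-- The difference quotient `D^{n,y,z} φ(η) = (n-1) (φ(η + e_{yz}/(n-1)) - φ(η))`. -/
def diffQuot {d : ℕ} (n : ℕ) (y z : Fin d) (φ : Vec d → ℝ) (η : Vec d) : ℝ :=
  ((n : ℝ) - 1) * (φ (η + (1 / ((n : ℝ) - 1)) • dir y z) - φ η)

/-- `V` is a classical solution of the HJB system of the `n`-player game. The measure variable is
the empirical measure of the `n - 1` other players. Whenever `η + e_{yz}/(n-1)` or
`η + e_{yx}/(n-1)` leaves the simplex, `η_y = 0`, so that the summand vanishes. -/
structure IsHJBSolution {d : ℕ} (n : ℕ) (T : ℝ) (f : Fin d → Vec d → Vec d → ℝ)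
    (g : Fin d → Vec d → ℝ) (astar : Fin d → Vec d → Vec d → Vec d)
    (V : ℝ → Fin d → Vec d → ℝ) : Prop where
  equation : ∀ t ∈ Icc 0 T, ∀ x, ∀ η ∈ grid d (n - 1),
    HasDerivWithinAt (fun s => V s x η)
      (-(∑ y, ∑ z, η y * diffQuot n y z (V t x) η *
            astar y (η + (1 / ((n : ℝ) - 1)) • dir y x)
              (delta y fun l => V t l (η + (1 / ((n : ℝ) - 1)) • dir y x)) z
          + ham f x η (delta x fun l => V t l η)))
      (Icc 0 T) t
  terminal : ∀ x, ∀ η ∈ grid d (n - 1), V T x η = g x η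

/-- `V` is the unique classical solution of the HJB system of the `n`-player game. -/
def IsUniqueHJBSolution {d : ℕ} (n : ℕ) (T : ℝ) (f : Fin d → Vec d → Vec d → ℝ)
    (g : Fin d → Vec d → ℝ) (astar : Fin d → Vec d → Vec d → Vec d)
    (V : ℝ → Fin d → Vec d → ℝ) : Prop :=
  IsHJBSolution n T f g astar V ∧
    ∀ V', IsHJBSolution n T f g astar V' →
      ∀ t ∈ Icc 0 T, ∀ x, ∀ η ∈ grid d (n - 1), V' t x η = V t x η

/-- `v` is the gradient at `η` of the function `φ` on the simplex: `v` is tangent to the simplex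
and `φ(ζ) = φ(η) + v · (ζ - η) + o(‖ζ - η‖)` as `ζ → η` inside the simplex. -/
def HasSimplexGradAt {d : ℕ} (φ : Vec d → ℝ) (v η : Vec d) : Prop :=
  ∑ i, v i = 0 ∧ HasFDerivWithinAt φ (innerSL ℝ v) (simplex d) η

/-- The gradient `∇_η φ` of a function on the simplex (meaningful where it exists). -/
def simplexGrad {d : ℕ} (φ : Vec d → ℝ) (η : Vec d) : Vec d :=
  Classical.epsilon fun v => HasSimplexGradAt φ v η

theorem convex_simplex (d : ℕ) : Convex ℝ (simplex d) := by
  intro a ha b hb s t hs ht hst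
  refine ⟨fun i => ?_, ?_⟩
  · have h1 := ha.1 i
    have h2 := hb.1 i
    simp only [PiLp.add_apply, PiLp.smul_apply, smul_eq_mul]
    positivity
  · simp only [PiLp.add_apply, PiLp.smul_apply, smul_eq_mul, Finset.sum_add_distrib,
      ← Finset.mul_sum, ha.2, hb.2, mul_one, hst]

theorem basisVec_mem_simplex {d : ℕ} (x : Fin d) : basisVec x ∈ simplex d := by
  refine ⟨fun i => ?_, ?_⟩
  · simp only [basisVec, PiLp.single_apply]
    split_ifs <;> norm_num
  · simp [basisVec, PiLp.single_apply]

/-- The gradient on the simplex is unique. -/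
theorem HasSimplexGradAt.unique {d : ℕ} {φ : Vec d → ℝ} {v w η : Vec d} (hη : η ∈ simplex d)
    (hv : HasSimplexGradAt φ v η) (hw : HasSimplexGradAt φ w η) : v = w := by
  have key : ∀ i, (v - w) i = inner ℝ (v - w) η := by
    intro i
    have hmem : basisVec i - η ∈ tangentConeAt ℝ (simplex d) η :=
      mem_tangentConeAt_of_segment_subset
        ((convex_simplex d).segment_subset hη (basisVec_mem_simplex i))
    have h := hv.2.unique_on hw.2 hmem
    simp only [innerSL_apply_apply, inner_sub_right] at h
    have h1 : ∀ u : Vec d, inner ℝ u (basisVec i) = u i := by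
      intro u
      simp [basisVec, EuclideanSpace.inner_single_right]
    rw [h1, h1] at h
    rw [inner_sub_left, PiLp.sub_apply]
    linarith
  have hsum : ∑ i, (v - w) i = 0 := by
    simp [PiLp.sub_apply, Finset.sum_sub_distrib, hv.1, hw.1]
  ext i
  have hd : (d : ℝ) ≠ 0 := by
    have : 0 < d := i.pos
    positivity
  rw [Finset.sum_congr rfl fun j _ => key j] at hsum
  simp only [Finset.sum_const, Finset.card_univ, Fintype.card_fin, nsmul_eq_mul] at hsum
  have h0 : inner ℝ (v - w) η = 0 := (mul_eq_zero.mp hsum).resolve_left hd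
  have := key i
  rw [h0, PiLp.sub_apply] at this
  linarith

theorem HasSimplexGradAt.simplexGrad_eq {d : ℕ} {φ : Vec d → ℝ} {v η : Vec d}
    (hη : η ∈ simplex d) (hv : HasSimplexGradAt φ v η) : simplexGrad φ η = v :=
  HasSimplexGradAt.unique hη
    (Classical.epsilon_spec (p := fun w => HasSimplexGradAt φ w η) ⟨v, hv⟩) hv

/-- `U` is a classical solution of the master equation: `U` is continuous, differentiable in time
and in the measure variable, and satisfies the equation everywhere. As `∑_z a^*_z = 0`, only the
tangential part of the gradient enters. -/
structure IsMasterSolution {d : ℕ} (T : ℝ) (f : Fin d → Vec d → Vec d → ℝ)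
    (g : Fin d → Vec d → ℝ) (astar : Fin d → Vec d → Vec d → Vec d)
    (U : ℝ → Fin d → Vec d → ℝ) : Prop where
  continuousOn : ∀ x, ContinuousOn (fun q : ℝ × Vec d => U q.1 x q.2) (Icc 0 T ×ˢ simplex d)
  grad : ∀ t ∈ Icc 0 T, ∀ x, ∀ η ∈ simplex d,
    HasSimplexGradAt (U t x) (simplexGrad (U t x) η) η
  equation : ∀ t ∈ Icc 0 T, ∀ x, ∀ η ∈ simplex d,
    HasDerivWithinAt (fun s => U s x η)
      (-(∑ y, ∑ z, simplexGrad (U t x) η z * η y * astar y η (delta y fun l => U t l η) z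
          + ham f x η (delta x fun l => U t l η)))
      (Icc 0 T) t
  terminal : ∀ x, ∀ η ∈ simplex d, U T x η = g x η

/-- `U` is the unique classical solution of the master equation. -/
def IsUniqueMasterSolution {d : ℕ} (T : ℝ) (f : Fin d → Vec d → Vec d → ℝ)
    (g : Fin d → Vec d → ℝ) (astar : Fin d → Vec d → Vec d → Vec d)
    (U : ℝ → Fin d → Vec d → ℝ) : Prop :=
  IsMasterSolution T f g astar U ∧
    ∀ U', IsMasterSolution T f g astar U' →
      ∀ t ∈ Icc 0 T, ∀ x, ∀ η ∈ simplex d, U' t x η = U t x η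

/-- The empirical measure `(1/(n-1)) ∑_{j ≠ i} e_{x_j}` of the players other than `i`. -/
def empOthers {d n : ℕ} (x : Fin n → Fin d) (i : Fin n) : Vec d :=
  (1 / ((n : ℝ) - 1)) • ∑ j ∈ Finset.univ.erase i, basisVec (x j)

/-- The rate at which player `i` moves to the state `z ≠ x_i` at time `t`, in the configuration
`x`, under the equilibrium feedback `a^*(x_i, μ^{n,i}, Δ_{x_i} V(t, ·, μ^{n,i}))`. -/
def eqRate {d n : ℕ} (astar : Fin d → Vec d → Vec d → Vec d) (V : ℝ → Fin d → Vec d → ℝ)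
    (t : ℝ) (x : Fin n → Fin d) (i : Fin n) (z : Fin d) : ℝ :=
  astar (x i) (empOthers x i) (delta (x i) fun l => V t l (empOthers x i)) z

/-- The generator at time `t` of the motion of the `n` players under the equilibrium feedback:
player `i` alone jumps to `z`, at rate `eqRate astar V t x i z`. -/
def generator {d n : ℕ} (astar : Fin d → Vec d → Vec d → Vec d) (V : ℝ → Fin d → Vec d → ℝ)
    (t : ℝ) (φ : (Fin n → Fin d) → ℝ) (x : Fin n → Fin d) : ℝ :=
  ∑ i, ∑ z ∈ Finset.univ.erase (x i),
    eqRate astar V t x i z * (φ (Function.update x i z) - φ x)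

/-- `X = (X^{n,1}, …, X^{n,n})` is, on the time interval `[t₀, T]`, the controlled jump process of
the `n` players under the equilibrium feedback: an adapted right-continuous process with left
limits that solves the martingale problem of the (time-dependent) generator. -/
structure IsEquilibriumProcess {d n : ℕ} (t₀ T : ℝ) (astar : Fin d → Vec d → Vec d → Vec d)
    (V : ℝ → Fin d → Vec d → ℝ) {Ω : Type*} [mΩ : MeasurableSpace Ω] (P : Measure Ω)
    (ℱ : Filtration (Icc t₀ T) mΩ) (X : ℝ → Ω → Fin n → Fin d) : Prop where
  adapted : ∀ t : Icc t₀ T, Measurable[ℱ t] (X t)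
  right_continuous : ∀ ω, ∀ t ∈ Ico t₀ T, ContinuousWithinAt (fun s => X s ω) (Ici t) t
  left_limit : ∀ ω, ∀ t ∈ Ioc t₀ T, ∃ l, Tendsto (fun s => X s ω) (𝓝[<] t) (𝓝 l)
  rate_integrable : ∀ᵐ ω ∂P, ∀ i, ∀ z,
    IntervalIntegrable (fun s => eqRate astar V s (X s ω) i z) volume t₀ T
  martingale : ∀ φ : (Fin n → Fin d) → ℝ,
    Martingale (fun (t : Icc t₀ T) ω =>
      φ (X t ω) - φ (X t₀ ω) - ∫ s in t₀..t, generator astar V s φ (X s ω)) ℱ P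

/-- The left limit `X(s-)`. -/
def leftState {d n : ℕ} {Ω : Type*} (X : ℝ → Ω → Fin n → Fin d) (s : ℝ) (ω : Ω) : Fin n → Fin d :=
  Function.leftLim (fun r => X r ω) s

end FiniteStateGame

end

open FiniteStateGame

namespace FiniteStateGame

/-! Both statements are averages of one deterministic bound: `|V n - U| ≤ C / n` uniformly in time,
state and grid point (`exists_abs_sub_le_div`). That bound comes from a maximum principle.

Restricted to the grid, `U` solves the HJB system up to an error of order `1/n`, because the
difference quotients of `U` differ from its gradient by `O(1/n)` and the measure argument of the
rates is shifted by `O(1/n)`. Let `W = V n - U`. Where `σ W` is maximal and equals `B = max |W|`,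
the transport term `∑ η_y D W a_z` has a favourable sign, since the rates off the diagonal are
nonnegative. By the Lipschitz assumptions, everything else is at most a constant times `B + 1/n`
(`mul_hjbDrift_sub_masterDrift_le`). Since `W` vanishes at time `T`, a Gronwall argument backward in
time, in barrier form (`abs_lt_exp_of_deriv_le_at_max`), keeps `|W|` below `exp((K+1)(T-t)) /
(n-1)`.

The Lipschitz bounds hold only for increments in `[-R, R]`, and those of `V n` are not known in
advance to lie there. By compactness the increments of `U` keep a distance `δ` from `R`
(`exists_gap`). As long as `|W|` is below the barrier and twice the barrier is at most `δ`, the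
increments of `V n` therefore stay in the box, so for large `n` the argument closes on itself. The
finitely many remaining `n` only enlarge the constant. -/

/-! ### Geometry of the simplex and of the grid -/

theorem norm_le_card_mul {d : ℕ} {v : Vec d} {s : ℝ} (hs : 0 ≤ s) (h : ∀ i, |v i| ≤ s) :
    ‖v‖ ≤ d * s := by
  rw [EuclideanSpace.norm_eq]
  refine Real.sqrt_le_iff.2 ⟨by positivity, ?_⟩
  calc ∑ i, ‖v i‖ ^ 2 ≤ ∑ _i : Fin d, s ^ 2 :=
        Finset.sum_le_sum fun i _ => pow_le_pow_left₀ (norm_nonneg _) (h i) 2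
    _ = d * s ^ 2 := by simp
    _ ≤ (d * s) ^ 2 := by
        have : (d : ℝ) ≤ (d : ℝ) ^ 2 := by exact_mod_cast Nat.le_self_pow two_ne_zero d
        rw [mul_pow]
        gcongr

theorem norm_basisVec {d : ℕ} (x : Fin d) : ‖basisVec x‖ = 1 := by
  simp [basisVec]

theorem norm_dir_le {d : ℕ} (y z : Fin d) : ‖dir y z‖ ≤ 2 := by
  refine (norm_sub_le _ _).trans ?_
  rw [norm_basisVec, norm_basisVec]
  norm_num

theorem inner_dir {d : ℕ} (v : Vec d) (y z : Fin d) : inner ℝ v (dir y z) = v z - v y := by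
  simp [dir, basisVec, inner_sub_right, EuclideanSpace.inner_single_right]

theorem dir_self {d : ℕ} (y : Fin d) : dir y y = 0 := sub_self _

theorem le_one_of_mem_simplex {d : ℕ} {η : Vec d} (hη : η ∈ simplex d) (i : Fin d) : η i ≤ 1 :=
  hη.2 ▸ Finset.single_le_sum (f := fun i => η i) (fun j _ => hη.1 j) (Finset.mem_univ i)

theorem norm_le_of_mem_simplex {d : ℕ} {η : Vec d} (hη : η ∈ simplex d) : ‖η‖ ≤ d := by
  simpa using norm_le_card_mul zero_le_one fun i => by
    rw [abs_of_nonneg (hη.1 i)]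
    exact le_one_of_mem_simplex hη i

theorem isCompact_simplex (d : ℕ) : IsCompact (simplex d) := by
  refine Metric.isCompact_of_isClosed_isBounded ?_ ?_
  · have h1 : IsClosed {η : Vec d | ∀ i, 0 ≤ η i} := by
      simp only [ofPred_forall]
      exact isClosed_iInter fun i => isClosed_le continuous_const (by fun_prop)
    have h2 : IsClosed {η : Vec d | ∑ i, η i = 1} :=
      isClosed_eq (by fun_prop) continuous_const
    exact h1.inter h2
  · exact (Metric.isBounded_closedBall (x := (0 : Vec d)) (r := d)).subset fun η hη => by
      simpa using norm_le_of_mem_simplex hη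

/-- Finiteness turns the HJB system into finitely many scalar functions of time, so that maxima over
the grid are attained. -/
theorem finite_grid {d m : ℕ} (hm : 0 < m) : (grid d m).Finite := by
  refine (Set.finite_range fun k : Fin d → Fin (m + 1) =>
    (WithLp.toLp 2 fun i => (k i : ℝ) / m : Vec d)).subset fun η hη => ?_
  have hm' : (0 : ℝ) < m := by exact_mod_cast hm
  choose k hk using hη.2
  have hkm : ∀ i, k i < m + 1 := fun i => by
    have : (k i : ℝ) ≤ m := by
      rw [← hk i]
      exact mul_le_of_le_one_right hm'.le (le_one_of_mem_simplex hη.1 i)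
    exact Nat.lt_succ_of_le (by exact_mod_cast this)
  refine ⟨fun i => ⟨k i, hkm i⟩, ?_⟩
  ext i
  simp only [← hk i]
  field_simp

theorem dir_apply {d : ℕ} (y z i : Fin d) :
    dir y z i = (if i = z then 1 else 0) - (if i = y then 1 else 0) := by
  simp [dir, basisVec, PiLp.single_apply]

/-- Moving one particle of a configuration with a particle in `y` gives a configuration. -/
theorem add_smul_dir_mem_grid {d m : ℕ} (hm : 0 < m) {η : Vec d} (hη : η ∈ grid d m)
    {y : Fin d} (hy : η y ≠ 0) (z : Fin d) : η + (1 / (m : ℝ)) • dir y z ∈ grid d m := by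
  have hm' : (0 : ℝ) < m := by exact_mod_cast hm
  have key : ∀ i, ∃ k : ℕ, (m : ℝ) * (η + (1 / (m : ℝ)) • dir y z) i = k := by
    intro i
    obtain ⟨k, hk⟩ := hη.2 i
    have hform : (m : ℝ) * (η + (1 / (m : ℝ)) • dir y z) i
        = k + ((if i = z then 1 else 0) - (if i = y then 1 else 0)) := by
      rw [PiLp.add_apply, PiLp.smul_apply, dir_apply, smul_eq_mul, mul_add, hk]
      field_simp
    rw [hform]
    by_cases h2 : i = y
    · subst h2
      -- There is a particle in `y` to remove, so the new count is still a natural number.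
      have hk0 : k ≠ 0 := by
        rintro rfl
        simp only [Nat.cast_zero, mul_eq_zero] at hk
        exact hk.elim hm'.ne' hy
      obtain ⟨j, rfl⟩ := Nat.exists_eq_succ_of_ne_zero hk0
      by_cases h1 : i = z
      · exact ⟨j + 1, by simp [h1]⟩
      · exact ⟨j, by simp [h1]⟩
    · by_cases h1 : i = z
      · exact ⟨k + 1, by simp [h1, h1 ▸ h2]⟩
      · exact ⟨k, by simp [h1, h2]⟩
  refine ⟨⟨fun i => ?_, ?_⟩, key⟩
  · obtain ⟨k, hk⟩ := key i
    have : 0 ≤ (m : ℝ) * (η + (1 / (m : ℝ)) • dir y z) i := hk ▸ Nat.cast_nonneg k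
    exact nonneg_of_mul_nonneg_right this hm'
  · simp only [PiLp.add_apply, PiLp.smul_apply, dir_apply, smul_eq_mul, Finset.sum_add_distrib,
      hη.1.2, ← Finset.mul_sum, Finset.sum_sub_distrib, Finset.sum_ite_eq', Finset.mem_univ]
    simp

/-- The empirical measure of the other players lies on the grid. -/
theorem empOthers_mem_grid {d n : ℕ} (hn : 2 ≤ n) (x : Fin n → Fin d) (i : Fin n) :
    empOthers x i ∈ grid d (n - 1) := by
  have hn' : (0 : ℝ) < (n : ℝ) - 1 := by
    have : (2 : ℝ) ≤ n := by exact_mod_cast hn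
    linarith
  have hcast : ((n - 1 : ℕ) : ℝ) = (n : ℝ) - 1 := by
    rw [Nat.cast_sub (by omega), Nat.cast_one]
  have happ : ∀ l, empOthers x i l = (1 / ((n : ℝ) - 1)) *
      ((Finset.univ.erase i).filter fun j => x j = l).card := by
    intro l
    rw [Finset.card_filter, Nat.cast_sum]
    simp only [empOthers, basisVec, PiLp.smul_apply, smul_eq_mul, WithLp.ofLp_sum,
      Finset.sum_apply, PiLp.single_apply, Nat.cast_ite, Nat.cast_one, Nat.cast_zero]
    exact congrArg _ (Finset.sum_congr rfl fun j _ => by simp only [eq_comm])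
  refine ⟨⟨fun l => ?_, ?_⟩, fun l => ⟨((Finset.univ.erase i).filter fun j => x j = l).card, ?_⟩⟩
  · rw [happ]
    positivity
  · simp only [happ, ← Finset.mul_sum]
    rw [← Nat.cast_sum, ← Finset.card_eq_sum_card_fiberwise fun _ _ =>
      Finset.mem_coe.2 (Finset.mem_univ _)]
    rw [Finset.card_erase_of_mem (Finset.mem_univ i), Finset.card_univ, Fintype.card_fin, hcast]
    field_simp
  · rw [happ, hcast]
    field_simp

/-- Conservation of mass: in the master equation, `∂_z U` may be replaced by `∂_z U - ∂_y U`, the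
derivative along `e_{yz}`. -/
theorem sum_eq_zero_of_mem_rateSet {d : ℕ} {x : Fin d} {a : Vec d} (ha : a ∈ rateSet x) :
    ∑ z, a z = 0 := by
  rw [← Finset.add_sum_erase _ _ (Finset.mem_univ x), ha.2]
  ring

/-! ### Calculus on the simplex -/

/-- A function on the simplex with bounded gradient is Lipschitz. -/
theorem abs_sub_le_of_simplexGrad_le {d : ℕ} {φ : Vec d → ℝ} {c : ℝ}
    (hφ : ∀ η ∈ simplex d, HasSimplexGradAt φ (simplexGrad φ η) η)
    (hc : ∀ η ∈ simplex d, ‖simplexGrad φ η‖ ≤ c) {η ζ : Vec d} (hη : η ∈ simplex d)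
    (hζ : ζ ∈ simplex d) : |φ ζ - φ η| ≤ c * ‖ζ - η‖ :=
  (convex_simplex d).norm_image_sub_le_of_norm_hasFDerivWithin_le (fun ξ hξ => (hφ ξ hξ).2)
    (fun ξ hξ => by simpa using hc ξ hξ) hη hζ

/-- First order Taylor estimate for a function on the simplex with Lipschitz gradient. -/
theorem abs_sub_sub_inner_le {d : ℕ} {φ : Vec d → ℝ} {l : ℝ} (hl : 0 ≤ l)
    (hφ : ∀ η ∈ simplex d, HasSimplexGradAt φ (simplexGrad φ η) η)
    (hlip : ∀ η ∈ simplex d, ∀ ζ ∈ simplex d,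
      ‖simplexGrad φ η - simplexGrad φ ζ‖ ≤ l * ‖η - ζ‖)
    {η ζ : Vec d} (hη : η ∈ simplex d) (hζ : ζ ∈ simplex d) :
    |φ ζ - φ η - inner ℝ (simplexGrad φ η) (ζ - η)| ≤ l * ‖ζ - η‖ * ‖ζ - η‖ := by
  have hsub : segment ℝ η ζ ⊆ simplex d := (convex_simplex d).segment_subset hη hζ
  -- Mean value inequality for `φ` minus its linearization at `η`: on the segment the gradient
  -- deviates from its value at `η` by at most `l * ‖ζ - η‖`.
  have h := (convex_segment (𝕜 := ℝ) η ζ).norm_image_sub_le_of_norm_hasFDerivWithin_le'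
    (f := φ) (f' := fun ξ => innerSL ℝ (simplexGrad φ ξ)) (φ := innerSL ℝ (simplexGrad φ η))
    (C := l * ‖ζ - η‖)
    (fun ξ hξ => (hφ ξ (hsub hξ)).2.mono hsub)
    (fun ξ hξ => by
      rw [← map_sub, innerSL_apply_norm]
      refine (hlip ξ (hsub hξ) η hη).trans (mul_le_mul_of_nonneg_left ?_ hl)
      obtain ⟨s, hs, rfl⟩ := (segment_eq_image' ℝ η ζ ▸ hξ)
      rw [add_sub_cancel_left, norm_smul, Real.norm_of_nonneg hs.1]
      exact mul_le_of_le_one_left (norm_nonneg _) hs.2)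
    (left_mem_segment ℝ η ζ) (right_mem_segment ℝ η ζ)
  simpa using h

/-- A function that is nonnegative at a point and nonpositive to its right has a nonpositive right
derivative there. -/
theorem nonpos_of_hasDerivWithinAt_Icc {φ : ℝ → ℝ} {φ' a b t : ℝ} (ht : t ∈ Icc a b) (htb : t < b)
    (hφ : HasDerivWithinAt φ φ' (Icc a b) t) (h0 : 0 ≤ φ t) (hle : ∀ s ∈ Ioc t b, φ s ≤ 0) :
    φ' ≤ 0 := by
  have h1 : HasDerivWithinAt φ φ' (Ioi t) t :=
    (hφ.mono fun s hs => ⟨ht.1.trans hs.1.le, hs.2⟩ : HasDerivWithinAt φ φ' (Ioc t b) t)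
      |>.mono_of_mem_nhdsWithin (Ioc_mem_nhdsGT htb)
  rw [hasDerivWithinAt_iff_tendsto_slope' (by simp)] at h1
  refine le_of_tendsto h1 ?_
  filter_upwards [Ioc_mem_nhdsGT htb] with s hs
  rw [slope_def_field]
  exact div_nonpos_of_nonpos_of_nonneg (by linarith [hle s hs]) (by linarith [hs.1])

/-! ### Comparison of the two drifts at a maximum of the error -/

/-- The right-hand side of the HJB system of the `n`-player game. -/
noncomputable def hjbDrift {d : ℕ} (n : ℕ) (f : Fin d → Vec d → Vec d → ℝ)
    (astar : Fin d → Vec d → Vec d → Vec d)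
    (v : Fin d → Vec d → ℝ) (x : Fin d) (η : Vec d) : ℝ :=
  ∑ y, ∑ z, η y * diffQuot n y z (v x) η *
      astar y (η + (1 / ((n : ℝ) - 1)) • dir y x)
        (delta y fun l => v l (η + (1 / ((n : ℝ) - 1)) • dir y x)) z
    + ham f x η (delta x fun l => v l η)

/-- The right-hand side of the master equation. -/
noncomputable def masterDrift {d : ℕ} (f : Fin d → Vec d → Vec d → ℝ)
    (astar : Fin d → Vec d → Vec d → Vec d)
    (u : Fin d → Vec d → ℝ) (x : Fin d) (η : Vec d) : ℝ :=
  ∑ y, ∑ z, simplexGrad (u x) η z * η y * astar y η (delta y fun l => u l η) z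
    + ham f x η (delta x fun l => u l η)

/-- The factor `n - 1` cancels the step size, leaving the Lipschitz constant times `‖e_{yz}‖ ≤ 2`.
-/
theorem abs_diffQuot_le {d n : ℕ} (hn : 2 ≤ n) {φ : Vec d → ℝ} {c : ℝ}
    (hφ : ∀ η ∈ simplex d, HasSimplexGradAt φ (simplexGrad φ η) η)
    (hc : ∀ η ∈ simplex d, ‖simplexGrad φ η‖ ≤ c) {η : Vec d} (hη : η ∈ simplex d) {y z : Fin d}
    (hζ : η + (1 / ((n : ℝ) - 1)) • dir y z ∈ simplex d) : |diffQuot n y z φ η| ≤ 2 * c := by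
  have hn' : (0 : ℝ) < (n : ℝ) - 1 := by
    have : (2 : ℝ) ≤ n := by exact_mod_cast hn
    linarith
  have hc0 : 0 ≤ c := (norm_nonneg _).trans (hc η hη)
  have h := abs_sub_le_of_simplexGrad_le hφ hc hη hζ
  rw [add_sub_cancel_left, norm_smul, Real.norm_of_nonneg (by positivity)] at h
  rw [diffQuot, abs_mul, abs_of_pos hn']
  calc _ ≤ ((n : ℝ) - 1) * (c * (1 / ((n : ℝ) - 1) * ‖dir y z‖)) := by gcongr
    _ = c * ‖dir y z‖ := by field_simp
    _ ≤ c * 2 := by gcongr; exact norm_dir_le y z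
    _ = 2 * c := mul_comm _ _

/-- Consistency error: the Taylor remainder is quadratic in a step of length at most `2/(n-1)`, and
the quotient loses one power. -/
theorem abs_diffQuot_sub_le {d n : ℕ} (hn : 2 ≤ n) {φ : Vec d → ℝ} {l : ℝ} (hl : 0 ≤ l)
    (hφ : ∀ η ∈ simplex d, HasSimplexGradAt φ (simplexGrad φ η) η)
    (hlip : ∀ η ∈ simplex d, ∀ ζ ∈ simplex d,
      ‖simplexGrad φ η - simplexGrad φ ζ‖ ≤ l * ‖η - ζ‖)
    {η : Vec d} (hη : η ∈ simplex d) {y z : Fin d}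
    (hζ : η + (1 / ((n : ℝ) - 1)) • dir y z ∈ simplex d) :
    |diffQuot n y z φ η - (simplexGrad φ η z - simplexGrad φ η y)|
      ≤ 4 * l * (1 / ((n : ℝ) - 1)) := by
  have hn' : (0 : ℝ) < (n : ℝ) - 1 := by
    have : (2 : ℝ) ≤ n := by exact_mod_cast hn
    linarith
  have h := abs_sub_sub_inner_le hl hφ hlip hη hζ
  rw [add_sub_cancel_left, norm_smul, Real.norm_of_nonneg (by positivity), inner_smul_right,
    inner_dir] at h
  have heq : diffQuot n y z φ η - (simplexGrad φ η z - simplexGrad φ η y)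
      = ((n : ℝ) - 1) * (φ (η + (1 / ((n : ℝ) - 1)) • dir y z) - φ η
        - 1 / ((n : ℝ) - 1) * (simplexGrad φ η z - simplexGrad φ η y)) := by
    rw [diffQuot]
    field_simp
  rw [heq, abs_mul, abs_of_pos hn']
  calc _ ≤ ((n : ℝ) - 1) * (l * (1 / ((n : ℝ) - 1) * ‖dir y z‖)
          * (1 / ((n : ℝ) - 1) * ‖dir y z‖)) := by gcongr
    _ = l * (1 / ((n : ℝ) - 1)) * (‖dir y z‖ * ‖dir y z‖) := by field_simp
    _ ≤ l * (1 / ((n : ℝ) - 1)) * (2 * 2) := by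
        gcongr <;> exact norm_dir_le y z
    _ = _ := by ring

/-- Where `σ (v - u)` attains the maximum `B` of `|v - u|` over the grid, the right-hand sides of
the HJB system and of the master equation compare up to a multiple of `B ≥ 1/(n-1)`. -/
theorem mul_hjbDrift_sub_masterDrift_le {d n : ℕ} (hn : 2 ≤ n)
    {f : Fin d → Vec d → Vec d → ℝ} {astar : Fin d → Vec d → Vec d → Vec d}
    {u v : Fin d → Vec d → ℝ} {R c l la ca lh B σ : ℝ} (hσ : |σ| = 1)
    (hl : 0 ≤ l) (hla : 0 ≤ la) (hlh : 0 ≤ lh) (hB : 1 / ((n : ℝ) - 1) ≤ B)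
    (hu : ∀ x, ∀ η ∈ simplex d, HasSimplexGradAt (u x) (simplexGrad (u x) η) η)
    (hc : ∀ x, ∀ η ∈ simplex d, ‖simplexGrad (u x) η‖ ≤ c)
    (hlip : ∀ x, ∀ η ∈ simplex d, ∀ ζ ∈ simplex d,
      ‖simplexGrad (u x) η - simplexGrad (u x) ζ‖ ≤ l * ‖η - ζ‖)
    (hmem : ∀ x, ∀ η ∈ simplex d, ∀ p, astar x η p ∈ rateSet x)
    (hastar : ∀ x, ∀ η ∈ simplex d, ∀ η' ∈ simplex d, ∀ p p' : Vec d,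
      (∀ i, |p i| ≤ R) → (∀ i, |p' i| ≤ R) →
      ‖astar x η p - astar x η' p'‖ ≤ la * (‖η - η'‖ + ‖p - p'‖))
    (hca : ∀ x, ∀ η ∈ simplex d, ∀ p : Vec d, (∀ i, |p i| ≤ R) → ‖astar x η p‖ ≤ ca)
    (hham : ∀ x, ∀ η ∈ simplex d, ∀ p p' : Vec d, (∀ i, |p i| ≤ R) → (∀ i, |p' i| ≤ R) →
      |ham f x η p - ham f x η p'| ≤ lh * ‖p - p'‖)
    (hbu : ∀ x y, ∀ η ∈ simplex d, |u y η - u x η| ≤ R)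
    (hbv : ∀ x y, ∀ η ∈ grid d (n - 1), |v y η - v x η| ≤ R)
    (hW : ∀ x, ∀ η ∈ grid d (n - 1), |v x η - u x η| ≤ B)
    {x : Fin d} {η : Vec d} (hη : η ∈ grid d (n - 1)) (hext : B ≤ σ * (v x η - u x η)) :
    σ * (hjbDrift n f astar v x η - masterDrift f astar u x η)
      ≤ (d * (2 * c * (la * (2 + 2 * d + 4 * d * c)) + 4 * l * ca) + lh * (2 * d)) * B := by
  have hn' : (0 : ℝ) < (n : ℝ) - 1 := by
    have : (2 : ℝ) ≤ n := by exact_mod_cast hn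
    linarith
  have hcast : ((n - 1 : ℕ) : ℝ) = (n : ℝ) - 1 := by
    rw [Nat.cast_sub (by omega), Nat.cast_one]
  have hB0 : 0 ≤ B := le_trans (by positivity) hB
  have hc0 : 0 ≤ c := (norm_nonneg _).trans (hc x η hη.1)
  have hca0 : 0 ≤ ca := (norm_nonneg _).trans
    (hca x η hη.1 (delta x fun l => u l η) fun i => hbu x i η hη.1)
  have hgrid : ∀ y z, η y ≠ 0 → η + (1 / ((n : ℝ) - 1)) • dir y z ∈ grid d (n - 1) := by
    intro y z hy
    have := add_smul_dir_mem_grid (by omega) hη hy z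
    rwa [hcast] at this
  have hdelta : ∀ y, ∀ ζ ∈ grid d (n - 1),
      ‖delta y (fun l => v l ζ) - delta y (fun l => u l ζ)‖ ≤ d * (2 * B) := by
    intro y ζ hζ
    refine norm_le_card_mul (by positivity) fun i => ?_
    have h1 := abs_le.1 (hW i ζ hζ)
    have h2 := abs_le.1 (hW y ζ hζ)
    simp only [delta, PiLp.sub_apply]
    rw [abs_le]
    constructor <;> linarith
  -- With `a`, `b` the rates for `v` and `u`, the bracket splits as `D(v - u) a + D u (a - b) + (D u
  -- - ∂u) b`: a term with a sign, a Lipschitz term and a consistency term.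
  have hterm : ∀ y z, η y * (σ * (diffQuot n y z (v x) η *
        astar y (η + (1 / ((n : ℝ) - 1)) • dir y x)
          (delta y fun l => v l (η + (1 / ((n : ℝ) - 1)) • dir y x)) z
        - (simplexGrad (u x) η z - simplexGrad (u x) η y)
          * astar y η (delta y fun l => u l η) z))
      ≤ η y * ((2 * c * (la * (2 + 2 * d + 4 * d * c)) + 4 * l * ca) * B) := by
    intro y z
    -- If `η y = 0`, the shifted points may leave the grid, but the weight removes the term.
    by_cases hy : η y = 0
    · simp [hy]
    refine mul_le_mul_of_nonneg_left ?_ (hη.1.1 y)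
    set ζ := η + (1 / ((n : ℝ) - 1)) • dir y x with hζdef
    have hζ : ζ ∈ grid d (n - 1) := hgrid y x hy
    have hζz := hgrid y z hy
    have hζη : ‖ζ - η‖ ≤ 2 * B := by
      rw [hζdef, add_sub_cancel_left, norm_smul, Real.norm_of_nonneg (by positivity)]
      calc _ ≤ B * 2 := by gcongr; exact norm_dir_le y x
        _ = 2 * B := mul_comm _ _
    set a := astar y ζ (delta y fun l => v l ζ) with ha
    set b := astar y η (delta y fun l => u l η) with hb
    -- The coefficient collects `2` from the shift of the measure, `2d` from replacing `v` by `u` at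
    -- `ζ`, and `4dc` from moving `u` from `ζ` to `η`.
    have hab : |a z - b z| ≤ la * ((2 + 2 * d + 4 * d * c) * B) := by
      have h1 : ‖delta y (fun l => u l ζ) - delta y (fun l => u l η)‖ ≤ d * (2 * (c * (2 * B))) := by
        refine norm_le_card_mul (by positivity) fun i => ?_
        have hlipU : ∀ j, |u j ζ - u j η| ≤ c * (2 * B) := fun j =>
          (abs_sub_le_of_simplexGrad_le (hu j) (hc j) hη.1 hζ.1).trans (by gcongr)
        have h1 := abs_le.1 (hlipU i)
        have h2 := abs_le.1 (hlipU y)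
        simp only [delta, PiLp.sub_apply]
        rw [abs_le]
        constructor <;> linarith
      have h2 := norm_sub_le_norm_sub_add_norm_sub (delta y fun l => v l ζ)
        (delta y fun l => u l ζ) (delta y fun l => u l η)
      have h3 := hdelta y ζ hζ
      calc |a z - b z| = ‖(a - b) z‖ := rfl
        _ ≤ ‖a - b‖ := PiLp.norm_apply_le _ _
        _ ≤ la * (‖ζ - η‖ + ‖(delta y fun l => v l ζ) - (delta y fun l => u l η)‖) :=
            hastar y ζ hζ.1 η hη.1 _ _ (fun i => hbv y i ζ hζ) fun i => hbu y i η hη.1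
        _ ≤ la * ((2 + 2 * d + 4 * d * c) * B) := by
            gcongr
            linarith
    have hbz : |b z| ≤ ca :=
      (PiLp.norm_apply_le b z).trans (hca y η hη.1 _ fun i => hbu y i η hη.1)
    have hDu := abs_diffQuot_le hn (hu x) (hc x) hη.1 hζz.1
    have hDg := (abs_diffQuot_sub_le hn hl (hu x) (hlip x) hη.1 hζz.1).trans
      (mul_le_mul_of_nonneg_left hB (by positivity : 0 ≤ 4 * l))
    -- Maximum principle: `σ (v - u)` cannot exceed `B` at the neighbouring grid point. The diagonal
    -- rate may be negative, but its difference quotient vanishes.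
    have hmax : σ * ((diffQuot n y z (v x) η - diffQuot n y z (u x) η) * a z) ≤ 0 := by
      by_cases hzy : z = y
      · subst hzy
        simp [diffQuot, dir_self]
      have haz : 0 ≤ a z := (hmem y ζ hζ.1 _).1 z hzy
      have hle : σ * (v x (η + (1 / ((n : ℝ) - 1)) • dir y z)
          - u x (η + (1 / ((n : ℝ) - 1)) • dir y z)) ≤ B := by
        refine (le_abs_self _).trans ?_
        rw [abs_mul, hσ, one_mul]
        exact hW x _ hζz
      have heq : σ * ((diffQuot n y z (v x) η - diffQuot n y z (u x) η) * a z)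
          = -(((n : ℝ) - 1) * a z * (σ * (v x η - u x η)
            - σ * (v x (η + (1 / ((n : ℝ) - 1)) • dir y z)
              - u x (η + (1 / ((n : ℝ) - 1)) • dir y z)))) := by
        simp only [diffQuot]
        ring
      rw [heq, neg_nonpos]
      exact mul_nonneg (mul_nonneg hn'.le haz) (by linarith)
    have hrest : σ * (diffQuot n y z (u x) η * (a z - b z)
        + (diffQuot n y z (u x) η - (simplexGrad (u x) η z - simplexGrad (u x) η y)) * b z)
        ≤ 2 * c * (la * ((2 + 2 * d + 4 * d * c) * B)) + 4 * l * B * ca := by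
      refine (le_abs_self _).trans ?_
      rw [abs_mul, hσ, one_mul]
      refine (abs_add_le _ _).trans ?_
      rw [abs_mul, abs_mul]
      gcongr
    linarith
  have hsum : hjbDrift n f astar v x η - masterDrift f astar u x η
      = (∑ y, ∑ z, η y * (diffQuot n y z (v x) η *
        astar y (η + (1 / ((n : ℝ) - 1)) • dir y x)
          (delta y fun l => v l (η + (1 / ((n : ℝ) - 1)) • dir y x)) z
        - (simplexGrad (u x) η z - simplexGrad (u x) η y)
          * astar y η (delta y fun l => u l η) z))
        + (ham f x η (delta x fun l => v l η) - ham f x η (delta x fun l => u l η)) := by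
    -- The rates sum to zero, so the component `∂_y u` can be inserted for free.
    have hz : ∀ y, ∑ z, η y * simplexGrad (u x) η y * astar y η (delta y fun l => u l η) z = 0 := by
      intro y
      rw [← Finset.mul_sum, sum_eq_zero_of_mem_rateSet (hmem y η hη.1 _), mul_zero]
    have hy : ∀ y, ∑ z, η y * (diffQuot n y z (v x) η *
        astar y (η + (1 / ((n : ℝ) - 1)) • dir y x)
          (delta y fun l => v l (η + (1 / ((n : ℝ) - 1)) • dir y x)) z
        - (simplexGrad (u x) η z - simplexGrad (u x) η y)
          * astar y η (delta y fun l => u l η) z)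
        = ∑ z, η y * diffQuot n y z (v x) η *
          astar y (η + (1 / ((n : ℝ) - 1)) • dir y x)
            (delta y fun l => v l (η + (1 / ((n : ℝ) - 1)) • dir y x)) z
          - ∑ z, simplexGrad (u x) η z * η y * astar y η (delta y fun l => u l η) z := by
      intro y
      refine Eq.trans ?_ (add_zero _)
      rw [← hz y, ← Finset.sum_sub_distrib, ← Finset.sum_add_distrib]
      exact Finset.sum_congr rfl fun z _ => by ring
    rw [Finset.sum_congr rfl fun y _ => hy y, Finset.sum_sub_distrib, hjbDrift, masterDrift]
    ring
  have hH : σ * (ham f x η (delta x fun l => v l η) - ham f x η (delta x fun l => u l η))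
      ≤ lh * (d * (2 * B)) := by
    refine (le_abs_self _).trans ?_
    rw [abs_mul, hσ, one_mul]
    exact (hham x η hη.1 _ _ (fun i => hbv x i η hη) fun i => hbu x i η hη.1).trans
      (mul_le_mul_of_nonneg_left (hdelta x η hη) hlh)
  have hS : σ * (∑ y, ∑ z, η y * (diffQuot n y z (v x) η *
        astar y (η + (1 / ((n : ℝ) - 1)) • dir y x)
          (delta y fun l => v l (η + (1 / ((n : ℝ) - 1)) • dir y x)) z
        - (simplexGrad (u x) η z - simplexGrad (u x) η y)
          * astar y η (delta y fun l => u l η) z))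
      ≤ d * ((2 * c * (la * (2 + 2 * d + 4 * d * c)) + 4 * l * ca) * B) := by
    rw [Finset.mul_sum]
    calc _ ≤ ∑ y, ∑ _z : Fin d,
            η y * ((2 * c * (la * (2 + 2 * d + 4 * d * c)) + 4 * l * ca) * B) := by
          refine Finset.sum_le_sum fun y _ => ?_
          rw [Finset.mul_sum]
          refine Finset.sum_le_sum fun z _ => ?_
          rw [mul_left_comm]
          exact hterm y z
      _ = _ := by
          simp only [Finset.sum_const, Finset.card_univ, Fintype.card_fin, nsmul_eq_mul]
          rw [← Finset.mul_sum, ← Finset.sum_mul, hη.1.2, one_mul]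
  rw [hsum, mul_add]
  linarith

/-! ### Backward comparison with an exponential barrier -/

/-- Backward comparison principle with an exponential barrier for finitely many functions whose
derivatives are controlled where the maximum of the absolute values touches the barrier. -/
theorem abs_lt_exp_of_deriv_le_at_max {ι : Type*} [Finite ι] {T h K : ℝ} (hh : 0 < h)
    {w w' : ι → ℝ → ℝ}
    (hw : ∀ i, ∀ t ∈ Icc 0 T, HasDerivWithinAt (w i) (w' i t) (Icc 0 T) t) (hT : ∀ i, w i T = 0)
    (hmax : ∀ t ∈ Icc 0 T, ∀ i, ∀ σ : ℝ, |σ| = 1 →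
      (∀ j, |w j t| ≤ h * Real.exp ((K + 1) * (T - t))) →
      h * Real.exp ((K + 1) * (T - t)) ≤ σ * w i t →
      σ * -w' i t ≤ K * (h * Real.exp ((K + 1) * (T - t)))) :
    ∀ t ∈ Icc 0 T, ∀ i, |w i t| < h * Real.exp ((K + 1) * (T - t)) := by
  set B : ℝ → ℝ := fun t => h * Real.exp ((K + 1) * (T - t)) with hB
  have hB0 : ∀ t, 0 < B t := fun t => by positivity
  have hBd : ∀ t, HasDerivAt B (-((K + 1) * B t)) t := by
    intro t
    have h1 : HasDerivAt (fun s => (K + 1) * (T - s)) ((K + 1) * -1) t :=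
      ((hasDerivAt_id t).const_sub T).const_mul _
    exact (h1.exp.const_mul h).congr_deriv (by simp only [hB]; ring)
  have hBc : Continuous B := by fun_prop
  have hwc : ∀ i, ContinuousOn (w i) (Icc 0 T) := fun i t ht => (hw i t ht).continuousWithinAt
  set S : Set ℝ := ⋃ i, {t ∈ Icc 0 T | B t ≤ |w i t|} with hS
  have hSclosed : IsClosed S :=
    isClosed_iUnion_of_finite fun i =>
      isClosed_Icc.isClosed_le hBc.continuousOn (continuous_abs.comp_continuousOn (hwc i))
  have hSsub : S ⊆ Icc 0 T := iUnion_subset fun i t ht => ht.1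
  by_contra! hcon
  obtain ⟨t₂, ht₂, i₂, hi₂⟩ := hcon
  have hne : S.Nonempty := ⟨t₂, mem_iUnion.2 ⟨i₂, ht₂, hi₂⟩⟩
  -- `t` is the last time at which some `|w i|` reaches the barrier; afterwards all of them are
  -- strictly below it, and by continuity none exceeds it at `t`.
  obtain ⟨t, htS, htmax⟩ := (isCompact_Icc.of_isClosed_subset hSclosed hSsub).exists_isGreatest hne
  obtain ⟨i, ht, hi⟩ := mem_iUnion.1 htS
  have htT : t < T := by
    refine lt_of_le_of_ne ht.2 ?_
    rintro rfl
    rw [hT i, abs_zero] at hi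
    exact absurd hi (hB0 t).not_ge
  have hafter : ∀ s ∈ Ioc t T, ∀ j, |w j s| < B s := by
    intro s hs j
    by_contra! hle
    exact absurd (htmax (mem_iUnion.2 ⟨j, ⟨ht.1.trans hs.1.le, hs.2⟩, hle⟩)) hs.1.not_ge
  have hat : ∀ j, |w j t| ≤ B t := by
    intro j
    have h1 : Tendsto (fun s => |w j s|) (𝓝[Ioc t T] t) (𝓝 |w j t|) :=
      ((hwc j t ht).mono fun s hs => ⟨ht.1.trans hs.1.le, hs.2⟩ : ContinuousWithinAt _ (Ioc t T) t).abs
    have h2 : Tendsto B (𝓝[Ioc t T] t) (𝓝 (B t)) := hBc.continuousWithinAt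
    have : (𝓝[Ioc t T] t).NeBot := by
      rw [nhdsWithin_Ioc_eq_nhdsGT htT]
      infer_instance
    exact le_of_tendsto_of_tendsto h1 h2
      (eventually_of_mem self_mem_nhdsWithin fun s hs => (hafter s hs j).le)
  obtain ⟨σ, hσ, hσi⟩ : ∃ σ : ℝ, |σ| = 1 ∧ |w i t| = σ * w i t := by
    rcases abs_choice (w i t) with h | h
    · exact ⟨1, by simp, by simpa using h⟩
    · exact ⟨-1, by simp, by simpa using h⟩
  have hle := hmax t ht i σ hσ hat (hσi ▸ hi)
  -- This gives `σ w' + (K + 1) B ≤ 0`, while `hle` gives `σ w' ≥ -K B`. The extra `1` in the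
  -- exponent makes these contradict `B > 0`.
  have hder := nonpos_of_hasDerivWithinAt_Icc ht htT
    (((hw i t ht).const_mul σ).sub (hBd t).hasDerivWithinAt) (by
      simp only [Pi.sub_apply]
      linarith) (fun s hs => by
      have h1 := hafter s hs i
      have h2 := le_abs_self (σ * w i s)
      rw [abs_mul, hσ, one_mul] at h2
      simp only [Pi.sub_apply]
      linarith)
  have := hB0 t
  change σ * -w' i t ≤ K * B t at hle
  linarith

/-! ### A priori bounds from compactness -/

/-- The increments of a master solution stay away from any strict upper bound. -/
theorem IsMasterSolution.exists_gap {d : ℕ} {T : ℝ} {f : Fin d → Vec d → Vec d → ℝ}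
    {g : Fin d → Vec d → ℝ} {astar : Fin d → Vec d → Vec d → Vec d} {U : ℝ → Fin d → Vec d → ℝ}
    (hU : IsMasterSolution T f g astar U) {R : ℝ}
    (hR : ∀ t ∈ Icc 0 T, ∀ x y, ∀ η ∈ simplex d, |U t y η - U t x η| < R) :
    ∃ δ : ℝ, 0 < δ ∧ ∀ t ∈ Icc 0 T, ∀ x y, ∀ η ∈ simplex d, |U t y η - U t x η| + δ ≤ R := by
  have hK : IsCompact (Icc 0 T ×ˢ simplex d) := isCompact_Icc.prod (isCompact_simplex d)
  have h1 : ∀ q : Fin d × Fin d, ∃ δ : ℝ, 0 < δ ∧ ∀ t ∈ Icc 0 T, ∀ η ∈ simplex d,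
      |U t q.2 η - U t q.1 η| + δ ≤ R := by
    rintro ⟨x, y⟩
    rcases (Icc 0 T ×ˢ simplex d).eq_empty_or_nonempty with he | hne
    · refine ⟨1, one_pos, fun t ht η hη => ?_⟩
      exact absurd (he ▸ mk_mem_prod ht hη : (t, η) ∈ (∅ : Set (ℝ × Vec d))) (notMem_empty _)
    obtain ⟨⟨s, ζ⟩, hs, hmax⟩ := hK.exists_isMaxOn hne
      (((hU.continuousOn y).sub (hU.continuousOn x)).abs)
    refine ⟨R - |U s y ζ - U s x ζ|, sub_pos.2 (hR s hs.1 x y ζ hs.2), fun t ht η hη => ?_⟩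
    have : |U t y η - U t x η| ≤ |U s y ζ - U s x ζ| := hmax (mk_mem_prod ht hη)
    linarith
  choose δ hδ0 hδ using h1
  rcases isEmpty_or_nonempty (Fin d × Fin d) with he | hne
  · exact ⟨1, one_pos, fun t _ x => (he.false (x, x)).elim⟩
  obtain ⟨q, hq⟩ := Finite.exists_min δ
  exact ⟨δ q, hδ0 q, fun t ht x y η hη => by linarith [hδ (x, y) t ht η hη, hq (x, y)]⟩

/-- A vector field on the box that is Lipschitz in both variables is bounded there. -/
theorem exists_norm_le_of_lipschitz {d : ℕ} {astar : Fin d → Vec d → Vec d → Vec d} {la R : ℝ}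
    (hla : 0 ≤ la) (hR : 0 ≤ R)
    (h : ∀ x, ∀ η ∈ simplex d, ∀ η' ∈ simplex d, ∀ p p' : Vec d,
      (∀ i, |p i| ≤ R) → (∀ i, |p' i| ≤ R) →
      ‖astar x η p - astar x η' p'‖ ≤ la * (‖η - η'‖ + ‖p - p'‖)) :
    ∃ ca : ℝ, ∀ x, ∀ η ∈ simplex d, ∀ p : Vec d, (∀ i, |p i| ≤ R) → ‖astar x η p‖ ≤ ca := by
  -- The reference point is `(basisVec x, 0)`. The sum over `x` makes the bound independent of the
  -- state, and the rest bounds the distance of a point of the box from the reference point.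
  refine ⟨∑ x, ‖astar x (basisVec x) 0‖ + la * ((d + d) + d * R), fun x η hη p hp => ?_⟩
  have hb := basisVec_mem_simplex x
  have h1 := h x η hη (basisVec x) hb p 0 hp fun i => by simpa using hR
  have h2 : ‖η - basisVec x‖ ≤ d + d := (norm_sub_le _ _).trans
    (add_le_add (norm_le_of_mem_simplex hη) (norm_le_of_mem_simplex hb))
  have h3 : ‖p - 0‖ ≤ d * R := by
    rw [sub_zero]
    exact norm_le_card_mul hR hp
  have h4 : ‖astar x (basisVec x) 0‖ ≤ ∑ x, ‖astar x (basisVec x) 0‖ :=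
    Finset.single_le_sum (f := fun x => ‖astar x (basisVec x) 0‖) (fun _ _ => norm_nonneg _)
      (Finset.mem_univ x)
  have h5 := norm_le_norm_add_norm_sub' (astar x η p) (astar x (basisVec x) 0)
  calc ‖astar x η p‖ ≤ ‖astar x (basisVec x) 0‖ + ‖astar x η p - astar x (basisVec x) 0‖ := h5
    _ ≤ _ := add_le_add h4 (h1.trans (by gcongr))

/-- For each number of players, the distance of the two value functions is bounded. -/
theorem exists_abs_sub_le {d n : ℕ} (hn : 2 ≤ n) {T : ℝ} {f : Fin d → Vec d → Vec d → ℝ}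
    {g : Fin d → Vec d → ℝ} {astar : Fin d → Vec d → Vec d → Vec d} {U V : ℝ → Fin d → Vec d → ℝ}
    (hV : IsHJBSolution n T f g astar V) (hU : IsMasterSolution T f g astar U) :
    ∃ M : ℝ, 0 ≤ M ∧ ∀ t ∈ Icc 0 T, ∀ x, ∀ η ∈ grid d (n - 1), |V t x η - U t x η| ≤ M := by
  have : Finite (grid d (n - 1)) := finite_grid (by omega)
  have h1 : ∀ q : Fin d × grid d (n - 1), ∃ M : ℝ, ∀ t ∈ Icc 0 T,
      ‖V t q.1 q.2 - U t q.1 q.2‖ ≤ M := fun q =>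
    isCompact_Icc.exists_bound_of_continuousOn fun t ht =>
      ((hV.equation t ht q.1 q.2 q.2.2).continuousWithinAt).sub
        ((hU.equation t ht q.1 q.2 q.2.2.1).continuousWithinAt)
  choose M hM using h1
  have := Fintype.ofFinite (Fin d × grid d (n - 1))
  refine ⟨∑ q, |M q|, by positivity, fun t ht x η hη => (hM (x, ⟨η, hη⟩) t ht).trans ?_⟩
  exact (le_abs_self _).trans
    (Finset.single_le_sum (f := fun q => |M q|) (fun _ _ => abs_nonneg _) (Finset.mem_univ _))

/-! ### Uniform convergence with rate `1/n` -/

/-- Uniform convergence, with rate `1/n`, of the value functions of the `n`-player games to the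
solution of the master equation. -/
theorem exists_abs_sub_le_div {d : ℕ} (hd : 0 < d) {T : ℝ} (hT : 0 ≤ T)
    {f : Fin d → Vec d → Vec d → ℝ} {g : Fin d → Vec d → ℝ}
    {astar : Fin d → Vec d → Vec d → Vec d} {V : ℕ → ℝ → Fin d → Vec d → ℝ}
    {U : ℝ → Fin d → Vec d → ℝ}
    (hmem : ∀ x, ∀ η ∈ simplex d, ∀ p, astar x η p ∈ rateSet x)
    (hV : ∀ n, 2 ≤ n → IsHJBSolution n T f g astar (V n)) (hU : IsMasterSolution T f g astar U)
    (hgrad_bdd : ∃ c : ℝ, ∀ t ∈ Icc 0 T, ∀ x, ∀ η ∈ simplex d, ‖simplexGrad (U t x) η‖ ≤ c)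
    (hgrad_lip : ∃ cL : ℝ, ∀ t ∈ Icc 0 T, ∀ x, ∀ η ∈ simplex d, ∀ η' ∈ simplex d,
      ‖simplexGrad (U t x) η - simplexGrad (U t x) η'‖ ≤ cL * ‖η - η'‖)
    {R : ℝ} (hR : ∀ t ∈ Icc 0 T, ∀ x y, ∀ η ∈ simplex d, |U t y η - U t x η| < R)
    (hastar_lip : ∃ cL : ℝ, ∀ x, ∀ η ∈ simplex d, ∀ η' ∈ simplex d, ∀ p p' : Vec d,
      (∀ i, |p i| ≤ R) → (∀ i, |p' i| ≤ R) →
      ‖astar x η p - astar x η' p'‖ ≤ cL * (‖η - η'‖ + ‖p - p'‖))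
    (hham_lip : ∃ cL : ℝ, ∀ x, ∀ η ∈ simplex d, ∀ p p' : Vec d,
      (∀ i, |p i| ≤ R) → (∀ i, |p' i| ≤ R) →
      |ham f x η p - ham f x η p'| ≤ cL * ‖p - p'‖) :
    ∃ C : ℝ, 0 < C ∧ ∀ n : ℕ, 2 ≤ n → ∀ t ∈ Icc 0 T, ∀ x, ∀ η ∈ grid d (n - 1),
      |V n t x η - U t x η| ≤ C / n := by
  obtain ⟨c, hc⟩ := hgrad_bdd
  obtain ⟨l', hl'⟩ := hgrad_lip
  obtain ⟨la', hla'⟩ := hastar_lip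
  obtain ⟨lh', hlh'⟩ := hham_lip
  obtain ⟨l, hl0, hl⟩ : ∃ l : ℝ, 0 ≤ l ∧ ∀ t ∈ Icc 0 T, ∀ x, ∀ η ∈ simplex d, ∀ η' ∈ simplex d,
      ‖simplexGrad (U t x) η - simplexGrad (U t x) η'‖ ≤ l * ‖η - η'‖ :=
    ⟨|l'|, abs_nonneg _, fun t ht x η hη η' hη' => (hl' t ht x η hη η' hη').trans
      (mul_le_mul_of_nonneg_right (le_abs_self _) (norm_nonneg _))⟩
  obtain ⟨la, hla0, hla⟩ : ∃ la : ℝ, 0 ≤ la ∧ ∀ x, ∀ η ∈ simplex d, ∀ η' ∈ simplex d,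
      ∀ p p' : Vec d, (∀ i, |p i| ≤ R) → (∀ i, |p' i| ≤ R) →
      ‖astar x η p - astar x η' p'‖ ≤ la * (‖η - η'‖ + ‖p - p'‖) :=
    ⟨|la'|, abs_nonneg _, fun x η hη η' hη' p p' hp hp' => (hla' x η hη η' hη' p p' hp hp').trans
      (mul_le_mul_of_nonneg_right (le_abs_self _) (by positivity))⟩
  obtain ⟨lh, hlh0, hlh⟩ : ∃ lh : ℝ, 0 ≤ lh ∧ ∀ x, ∀ η ∈ simplex d, ∀ p p' : Vec d,
      (∀ i, |p i| ≤ R) → (∀ i, |p' i| ≤ R) →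
      |ham f x η p - ham f x η p'| ≤ lh * ‖p - p'‖ :=
    ⟨|lh'|, abs_nonneg _, fun x η hη p p' hp hp' => (hlh' x η hη p p' hp hp').trans
      (mul_le_mul_of_nonneg_right (le_abs_self _) (norm_nonneg _))⟩
  obtain ⟨δ, hδ0, hδ⟩ := hU.exists_gap hR
  have hR0 : 0 ≤ R := (abs_nonneg _).trans
    (hR 0 ⟨le_rfl, hT⟩ ⟨0, hd⟩ ⟨0, hd⟩ _ (basisVec_mem_simplex ⟨0, hd⟩)).le
  obtain ⟨ca, hca⟩ := exists_norm_le_of_lipschitz hla0 hR0 hla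
  have hc0 : 0 ≤ c := (norm_nonneg _).trans
    (hc 0 ⟨le_rfl, hT⟩ ⟨0, hd⟩ _ (basisVec_mem_simplex ⟨0, hd⟩))
  have hca0 : 0 ≤ ca := (norm_nonneg _).trans
    (hca ⟨0, hd⟩ _ (basisVec_mem_simplex ⟨0, hd⟩) 0 fun i => by simpa using hR0)
  set K : ℝ := d * (2 * c * (la * (2 + 2 * d + 4 * d * c)) + 4 * l * ca) + lh * (2 * d) with hK
  have hK0 : 0 ≤ K := by positivity
  set E : ℝ := Real.exp ((K + 1) * T) with hE
  have hE0 : 0 < E := Real.exp_pos _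
  -- The barrier is largest at time `0`, with value `E / (n - 1)`; twice this must fit into the gap
  -- `δ`.
  have hlarge : ∀ n : ℕ, 2 ≤ n → 2 * (1 / ((n : ℝ) - 1) * E) ≤ δ → ∀ t ∈ Icc 0 T, ∀ x,
      ∀ η ∈ grid d (n - 1), |V n t x η - U t x η| ≤ 2 * E / n := by
    intro n hn hnδ
    have hn2 : (2 : ℝ) ≤ n := by exact_mod_cast hn
    have hh : 0 < 1 / ((n : ℝ) - 1) := one_div_pos.2 (by linarith)
    have : Finite (grid d (n - 1)) := finite_grid (by omega)
    have hexp : ∀ t ∈ Icc 0 T, 1 / ((n : ℝ) - 1) * Real.exp ((K + 1) * (T - t))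
        ≤ 1 / ((n : ℝ) - 1) * E := by
      intro t ht
      have : T - t ≤ T := by linarith [ht.1]
      rw [hE]
      gcongr
    have key := abs_lt_exp_of_deriv_le_at_max (ι := Fin d × grid d (n - 1)) (T := T) (K := K) hh
      (w := fun q t => V n t q.1 q.2 - U t q.1 q.2)
      (w' := fun q t => -hjbDrift n f astar (V n t) q.1 q.2 - -masterDrift f astar (U t) q.1 q.2)
      (fun q t ht => ((hV n hn).equation t ht q.1 q.2 q.2.2).sub
        (hU.equation t ht q.1 q.2 q.2.2.1))
      (fun q => by
        rw [(hV n hn).terminal _ _ q.2.2, hU.terminal _ _ q.2.2.1, sub_self])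
      (fun t ht q σ hσ hB hext => by
        have hW : ∀ x, ∀ η ∈ grid d (n - 1), |V n t x η - U t x η|
            ≤ 1 / ((n : ℝ) - 1) * Real.exp ((K + 1) * (T - t)) :=
          fun x η hη => hB (x, ⟨η, hη⟩)
        have h1 := mul_hjbDrift_sub_masterDrift_le hn (f := f) (R := R) hσ hl0 hla0 hlh0
          (le_mul_of_one_le_right hh.le
            (Real.one_le_exp (mul_nonneg (by linarith) (by linarith [ht.2]))))
          (hU.grad t ht) (hc t ht) (hl t ht) hmem hla hca hlh
          (fun x y η hη => (hR t ht x y η hη).le)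
          -- An increment of `V n` differs from that of `U` by at most twice the barrier, hence by
          -- at most `δ`, and so stays in the box.
          (fun x y η hη => by
            have h2 := hδ t ht x y η hη.1
            have h3 := hexp t ht
            have h4 := abs_le.1 (hW x η hη)
            have h5 := abs_le.1 (hW y η hη)
            have h6 := abs_le.1 (le_refl |U t y η - U t x η|)
            rw [abs_le]
            constructor <;> linarith)
          hW q.2.2 hext
        rw [← hK] at h1
        refine le_of_eq_of_le ?_ h1
        ring)
    intro t ht x η hη
    refine (key t ht (x, ⟨η, hη⟩)).le.trans ((hexp t ht).trans ?_)
    -- `1/(n-1) ≤ 2/n` for `n ≥ 2`.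
    rw [one_div_mul_eq_div, div_le_div_iff₀ (by linarith) (by linarith)]
    nlinarith
  obtain ⟨N, hN⟩ := exists_nat_gt (2 * E / δ + 1)
  have hbdd : ∀ n : ℕ, ∃ M : ℝ, 0 ≤ M ∧ (2 ≤ n → ∀ t ∈ Icc 0 T, ∀ x, ∀ η ∈ grid d (n - 1),
      |V n t x η - U t x η| ≤ M) := by
    intro n
    by_cases hn : 2 ≤ n
    · obtain ⟨M, hM0, hM⟩ := exists_abs_sub_le hn (hV n hn) hU
      exact ⟨M, hM0, fun _ => hM⟩
    · exact ⟨0, le_rfl, fun h => absurd h hn⟩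
  choose M hM0 hM using hbdd
  have hsum0 : 0 ≤ ∑ n ∈ Finset.range N, n * M n :=
    Finset.sum_nonneg fun n _ => mul_nonneg (Nat.cast_nonneg n) (hM0 n)
  -- Each `n < N` has some bound `M n`, and `n * M n` is one term of the sum.
  refine ⟨2 * E + ∑ n ∈ Finset.range N, n * M n, by positivity, fun n hn t ht x η hη => ?_⟩
  have hn2 : (2 : ℝ) ≤ n := by exact_mod_cast hn
  rcases lt_or_ge n N with hnN | hnN
  · refine (hM n hn t ht x η hη).trans ?_
    rw [le_div_iff₀ (by linarith), mul_comm]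
    have := Finset.single_le_sum (f := fun n : ℕ => n * M n)
      (fun n _ => mul_nonneg (Nat.cast_nonneg n) (hM0 n)) (Finset.mem_range.2 hnN)
    linarith
  · have hNn : (N : ℝ) ≤ n := by exact_mod_cast hnN
    refine (hlarge n hn ?_ t ht x η hη).trans ?_
    · have h1 : 2 * E / δ < (n : ℝ) - 1 := by linarith
      rw [div_lt_iff₀ hδ0] at h1
      rw [one_div_mul_eq_div, ← mul_div_assoc, div_le_iff₀ (by linarith)]
      linarith
    · gcongr
      linarith

end FiniteStateGame

/-! ### The main theorem -/

theorem theorem2p1 (d : ℕ) (hd : 2 ≤ d) (T : ℝ) (hT : 0 < T)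
    -- running cost, terminal cost, minimizer of the Hamiltonian
    (f : Fin d → Vec d → Vec d → ℝ)
    (g : Fin d → Vec d → ℝ)
    (astar : Fin d → Vec d → Vec d → Vec d)
    (hastar : IsUniqueMinimizer f astar)
    -- the solutions of the HJB systems and of the master equation
    (V : ℕ → ℝ → Fin d → Vec d → ℝ)
    (U : ℝ → Fin d → Vec d → ℝ)
    (hV : ∀ n, 2 ≤ n → IsUniqueHJBSolution n T f g astar (V n))
    (hU : IsUniqueMasterSolution T f g astar U)
    -- the gradient of `U` is bounded and Lipschitz
    (hgrad_bdd : ∃ c : ℝ, ∀ t ∈ Icc 0 T, ∀ x, ∀ η ∈ simplex d,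
      ‖simplexGrad (U t x) η‖ ≤ c)
    (hgrad_lip : ∃ cL : ℝ, ∀ t ∈ Icc 0 T, ∀ x, ∀ η ∈ simplex d,
      ∀ η' ∈ simplex d,
      ‖simplexGrad (U t x) η - simplexGrad (U t x) η'‖
        ≤ cL * ‖η - η'‖)
    -- the box `[-R, R]^d`, containing the increments of `U` in its interior, on which `a^*` and
    -- `H` are regular
    (R : ℝ)
    (hR : ∀ t ∈ Icc 0 T, ∀ x y, ∀ η ∈ simplex d, |U t y η - U t x η| < R)
    (hastar_lip : ∃ cL : ℝ, ∀ x, ∀ η ∈ simplex d,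
      ∀ η' ∈ simplex d, ∀ p p' : Vec d,
      (∀ i, |p i| ≤ R) → (∀ i, |p' i| ≤ R) →
      ‖astar x η p - astar x η' p'‖ ≤ cL * (‖η - η'‖ + ‖p - p'‖))
    (hastar_pos : ∃ c : ℝ, 0 < c ∧ ∀ x y, x ≠ y → ∀ η ∈ simplex d,
      ∀ p : Vec d, (∀ i, |p i| ≤ R) → c ≤ astar x η p y)
    (hham_lip : ∃ cL : ℝ, ∀ x, ∀ η ∈ simplex d,
      ∀ p p' : Vec d, (∀ i, |p i| ≤ R) → (∀ i, |p' i| ≤ R) →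
      |ham f x η p - ham f x η p'| ≤ cL * ‖p - p'‖) :
    ∃ C : ℝ, 0 < C ∧ ∀ t₀ ∈ Icc 0 T, ∀ n : ℕ, 2 ≤ n →
      (∀ (Ω : Type*) [mΩ : MeasurableSpace Ω] (P : Measure Ω) [IsProbabilityMeasure P]
        (ℱ : Filtration (Icc t₀ T) mΩ) (X : ℝ → Ω → Fin n → Fin d),
        IsEquilibriumProcess t₀ T astar (V n) P ℱ X →
        iIndepFun (fun i ω => X t₀ ω i) P →
        (∀ i j, IdentDistrib (fun ω => X t₀ ω i) (fun ω => X t₀ ω j) P P) →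
        ∀ i : Fin n,
          (∫⁻ ω, ENNReal.ofReal
              ((V n t₀ (X t₀ ω i) (empOthers (X t₀ ω) i)
                - U t₀ (X t₀ ω i) (empOthers (X t₀ ω) i)) ^ 2) ∂P)
          + (∫⁻ s in Icc t₀ T, ∫⁻ ω, ENNReal.ofReal
              (‖delta (leftState X s ω i) (fun l =>
                  V n s l (empOthers (leftState X s ω) i)
                  - U s l (empOthers (leftState X s ω) i))‖
                ^ 2) ∂P)
          ≤ ENNReal.ofReal (C / (n : ℝ) ^ 2)) ∧
      (∀ x : Fin n → Fin d,
        (1 / (n : ℝ)) * ∑ i, |V n t₀ (x i) (empOthers x i)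
            - U t₀ (x i) (empOthers x i)| ≤ C / (n : ℝ)) := by
  obtain ⟨C, hC0, hC⟩ := exists_abs_sub_le_div (by omega) hT.le hastar.mem
    (fun n hn => (hV n hn).1) hU.1 hgrad_bdd hgrad_lip hR hastar_lip hham_lip
  -- The first summand serves (i): `C ^ 2` for the value at `t₀`, and `(2dC) ^ 2 T` for the integral
  -- of the squared increments. The second serves (ii).
  refine ⟨C ^ 2 * (1 + 4 * d ^ 2 * T) + C, by positivity, fun t₀ ht₀ n hn => ⟨?_, fun x => ?_⟩⟩
  · intro Ω mΩ P hP ℱ X _ _ _ i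
    have hn0 : (0 : ℝ) < n := by exact_mod_cast (by omega : 0 < n)
    have h1 : ∫⁻ ω, ENNReal.ofReal
        ((V n t₀ (X t₀ ω i) (empOthers (X t₀ ω) i)
          - U t₀ (X t₀ ω i) (empOthers (X t₀ ω) i)) ^ 2) ∂P ≤ ENNReal.ofReal ((C / n) ^ 2) := by
      refine (lintegral_mono fun ω => ENNReal.ofReal_le_ofReal
        (sq_le_sq' ?_ ?_)).trans_eq (by rw [lintegral_const, measure_univ, mul_one])
      all_goals
        have h := abs_le.1 (hC n hn t₀ ht₀ (X t₀ ω i) _ (empOthers_mem_grid hn (X t₀ ω) i))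
        linarith
    have h2 : ∫⁻ s in Icc t₀ T, ∫⁻ ω, ENNReal.ofReal
        (‖delta (leftState X s ω i) (fun l =>
            V n s l (empOthers (leftState X s ω) i)
            - U s l (empOthers (leftState X s ω) i))‖ ^ 2) ∂P
        ≤ ENNReal.ofReal ((d * (2 * (C / n))) ^ 2 * T) := by
      calc _ ≤ ∫⁻ _s in Icc t₀ T, ENNReal.ofReal ((d * (2 * (C / n))) ^ 2) := by
            refine setLIntegral_mono' measurableSet_Icc fun s hs => ?_
            have hs' : s ∈ Icc 0 T := ⟨ht₀.1.trans hs.1, hs.2⟩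
            refine (lintegral_mono fun ω => ENNReal.ofReal_le_ofReal
              (pow_le_pow_left₀ (norm_nonneg _) (norm_le_card_mul (s := 2 * (C / n)) (by positivity)
                fun l => ?_) 2)).trans_eq (by rw [lintegral_const, measure_univ, mul_one])
            -- The left limit is again a configuration, so the uniform bound applies to it.
            have hg := empOthers_mem_grid hn (leftState X s ω) i
            have h3 := abs_le.1 (hC n hn s hs' l _ hg)
            have h4 := abs_le.1 (hC n hn s hs' (leftState X s ω i) _ hg)
            simp only [delta]
            rw [abs_le]
            constructor <;> linarith
        _ = ENNReal.ofReal ((d * (2 * (C / n))) ^ 2 * (T - t₀)) := by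
            rw [setLIntegral_const, Real.volume_Icc, ← ENNReal.ofReal_mul (by positivity)]
        _ ≤ _ := ENNReal.ofReal_le_ofReal (by
            have := ht₀.1
            gcongr
            linarith)
    refine (add_le_add h1 h2).trans ?_
    rw [← ENNReal.ofReal_add (by positivity) (by positivity)]
    refine ENNReal.ofReal_le_ofReal ?_
    rw [le_div_iff₀ (by positivity)]
    have heq : ((C / n) ^ 2 + (d * (2 * (C / n))) ^ 2 * T) * (n : ℝ) ^ 2
        = C ^ 2 * (1 + 4 * d ^ 2 * T) := by
      field_simp
      ring
    linarith
  · have hn0 : (0 : ℝ) < n := by exact_mod_cast (by omega : 0 < n)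
    calc _ ≤ (1 / (n : ℝ)) * ∑ _i : Fin n, C / n := by
          gcongr with i
          exact hC n hn t₀ ht₀ _ _ (empOthers_mem_grid hn x i)
      _ = C / n := by
          simp only [Finset.sum_const, Finset.card_univ, Fintype.card_fin, nsmul_eq_mul]
          field_simp
      _ ≤ _ := by
          gcongr
          have : 0 ≤ C ^ 2 * (1 + 4 * d ^ 2 * T) := by positivity
          linarith
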